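/- Throughout, vector spaces are real. A vector lattice $F$ is an ordered vector space in which any two elements have a supremum and an infimum, and $F^+=\{a\in F: a\ge 0\}$; it is Archimedean if $\inf\{n^{-1}a: n\in\mathbb N,\ n\ge 1\}=0$ for every $a\in F^+$. An $f$-algebra is a vector lattice $F$ with a ring multiplication (associative and distributive, not assumed unital or commutative) such that $ab\in F^+$ for all $a,b\in F^+$, and such that $\inf\{a,b\}=0$ implies $\inf\{ac,b\}=\inf\{a,bc\}=0$ for all $c\in F^+$. It is semiprime if it has no nonzero nilpotent elements, and a semiprime $f$-algebra is square root closed if for every $a\in F^+$ there is a unique $b\in F^+$ with $b^2=a$; this $b$ is written $\sqrt a$. For $a,b\in F^+$ put $$a\boxtimes b:=2^{-1}\inf\{\theta a+\theta^{-1}b:\theta\in(0,\infty)\}$$ whenever this infimum exists in $F$, and call $F$ geometric mean closed if it exists for all $a,b\in F^+$. For a vector space $V$, a vector semi-inner product $T\colon V\times V\to F$ is a symmetric bilinear map with $T(x,x)\ge 0$ for all $x\in V$. **Theorem (Sharpened Triangle Inequality).** Let $V$ be a vector space, let $F$ be an Archimedean, square root closed, semiprime $f$-algebra, let $T\colon V\times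 V\to F$ be a vector semi-inner product, and let $u\in F^+$. Then $F$ is geometric mean closed, so that $\|z\|:=T(z,z)\boxtimes u$ is defined for every $z\in V$. Moreover, for all $x,y\in V$ the infimum below exists in $F$, the element under the square root is in $F^+$, and $$\|x+y\|\le\sqrt{(\|x\|+\|y\|)^2-\inf_{\lambda\in\mathbb R\setminus\{0\}}|\lambda|^{-1}\|\lambda x-y\|^2}\le\|x\|+\|y\|.$$ Furthermore, the first inequality is an equality if and only if $T(x,y)u\in F^+$. -/

import Mathlib

namespace VecSemiInner

/-- The Archimedean property of a vector lattice: the infimum of `u / n`, over the positive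
integers `n`, is `0` for every `u` in the positive cone. -/
def IsArchimedeanVL (F : Type*) [AddCommGroup F] [Lattice F] [Module ℝ F] : Prop :=
  ∀ u : F, 0 ≤ u → IsGLB {w : F | ∃ n : ℕ, 0 < n ∧ w = (n : ℝ)⁻¹ • u} 0

/-- The two axioms that make a vector lattice with a ring multiplication (associative and
distributive; no unit and no commutativity is assumed) an `f`-algebra. -/
structure IsFAlgebra (F : Type*) [NonUnitalRing F] [Lattice F] : Prop where
  mul_nonneg : ∀ x y : F, 0 ≤ x → 0 ≤ y → 0 ≤ x * y
  inf_mul : ∀ x y : F, x ⊓ y = 0 → ∀ z : F, 0 ≤ z → (x * z) ⊓ y = 0 ∧ x ⊓ (y * z) = 0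

/-- Free of (nonzero) nilpotents. The ring need not have a unit; `(fun b => a * b)^[n] a` is the
power of `a` with exponent `n + 1`. -/
def IsSemiprime (F : Type*) [NonUnitalRing F] : Prop :=
  ∀ (a : F) (n : ℕ), (fun b : F => a * b)^[n] a = 0 → a = 0

/-- Every positive element has a unique positive square root. -/
def SquareRootClosed (F : Type*) [NonUnitalRing F] [Lattice F] : Prop :=
  ∀ a : F, 0 ≤ a → ∃! b : F, 0 ≤ b ∧ b * b = a

open Classical in
/-- The square root `√a`: the unique `b ≥ 0` with `b * b = a`
(with the value `0` if there is no unique such `b`). -/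
noncomputable def vsqrt {F : Type*} [NonUnitalRing F] [Lattice F] (a : F) : F :=
  if h : ∃! b : F, 0 ≤ b ∧ b * b = a then h.choose else 0

open Classical in
/-- The infimum of a set in an ordered space (with the value `0` if it does not exist). -/
noncomputable def vinf {F : Type*} [Zero F] [Preorder F] (S : Set F) : F :=
  if h : ∃ m : F, IsGLB S m then h.choose else 0

/-- The set `{θ u + θ⁻¹ v : θ ∈ (0, ∞)}`. -/
def gmSet {F : Type*} [AddCommGroup F] [Module ℝ F] (u v : F) : Set F :=
  {w : F | ∃ θ : ℝ, 0 < θ ∧ w = θ • u + θ⁻¹ • v}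

/-- The infimum of `gmSet u v` exists for all positive `u`, `v`. -/
def GeometricMeanClosed (F : Type*) [AddCommGroup F] [Lattice F] [Module ℝ F] : Prop :=
  ∀ u v : F, 0 ≤ u → 0 ≤ v → ∃ m : F, IsGLB (gmSet u v) m

/-- The geometric mean `u ⊠ v = 2⁻¹ inf {θ u + θ⁻¹ v : θ ∈ (0, ∞)}`. -/
noncomputable def gmean {F : Type*} [AddCommGroup F] [Lattice F] [Module ℝ F] (u v : F) : F :=
  (2 : ℝ)⁻¹ • vinf (gmSet u v)

/-- `T` is a vector semi-inner product on `V` with values in `F`. -/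
structure IsVectorSemiInnerProduct {V F : Type*} [AddCommGroup V] [Module ℝ V]
    [AddCommGroup F] [Lattice F] [Module ℝ F] (T : V → V → F) : Prop where
  add_left : ∀ x y z : V, T (x + y) z = T x z + T y z
  add_right : ∀ x y z : V, T x (y + z) = T x y + T x z
  smul_left : ∀ (c : ℝ) (x y : V), c • T x y = T (c • x) y
  smul_right : ∀ (c : ℝ) (x y : V), c • T x y = T x (c • y)
  symm : ∀ x y : V, T x y = T y x
  nonneg : ∀ x : V, 0 ≤ T x x

/-- `‖x‖ = T(x,x) ⊠ u`. -/
noncomputable def vnorm {V F : Type*} [AddCommGroup F] [Lattice F] [Module ℝ F]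
    (T : V → V → F) (u : F) (x : V) : F :=
  gmean (T x x) u

/-- The set `{|c|⁻¹ ‖c x - y‖² : c ∈ ℝ, c ≠ 0}`. -/
def defectSet {V F : Type*} [AddCommGroup V] [Module ℝ V] [NonUnitalRing F] [Lattice F]
    [Module ℝ F] (T : V → V → F) (u : F) (x y : V) : Set F :=
  {w : F | ∃ c : ℝ, c ≠ 0 ∧ w = |c|⁻¹ • (vnorm T u (c • x - y) * vnorm T u (c • x - y))}

/-- `(‖x‖ + ‖y‖)² - inf {|c|⁻¹ ‖c x - y‖² : c ∈ ℝ, c ≠ 0}`. -/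
noncomputable def radicand {V F : Type*} [AddCommGroup V] [Module ℝ V] [NonUnitalRing F]
    [Lattice F] [Module ℝ F] (T : V → V → F) (u : F) (x y : V) : F :=
  (vnorm T u x + vnorm T u y) * (vnorm T u x + vnorm T u y) - vinf (defectSet T u x y)

end VecSemiInner

/-!
# The sharpened triangle inequality in an Archimedean semiprime `f`-algebra

Once the multiplication is known to be commutative and real bilinear, and the geometric mean of
positive `a`, `b` to be `√(a b)`, everything is a computation with squares. Put `A = T(x,x) u`,
`B = T(y,y) u` and `t = T(x,y) u`. Then `‖x‖² = A`, `‖y‖² = B` and `‖x + y‖² = A + B + 2 t`, while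
`|c|⁻¹ ‖c x - y‖² = |c| A + |c|⁻¹ B ∓ 2 t` according to the sign of `c`. Hence the infimum over `c`
is `2 ‖x‖ ‖y‖ - 2 |t|` (`IsFAlgebra.isGLB_defectSet`), and the radicand is `A + B + 2 |t|`. The
first inequality is `t ≤ |t|`, with equality exactly when `0 ≤ t`; the second one holds because the
infimum is nonnegative. Squares can be compared instead of positive elements by
`IsFAlgebra.le_of_mul_self_le`.

The identification of the geometric mean (`IsFAlgebra.isGLB_gmSet`) and commutativity
(`IsFAlgebra.mul_comm`) rest on the same order-theoretic fact, which replaces a representation of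
`F` by functions: a family `p μ` that varies slowly with `μ` and has `r ≤ |p μ|` throughout cannot
change its sign on `r` (`le_sup_of_forall_le_map_abs`). For `p μ = μ √a - μ⁻¹ √b` it shows that the
squares `μ² a + μ⁻² b - 2 √a √b` have infimum `0`. For commutativity, the `f`-algebra axiom only says
that *right* multiplications by positive elements preserve disjointness with every element, that is,
are positive orthomorphisms. Any two of these commute (`IsPosOrtho.map_comm`), so that
`c (a b - b a) = 0` for all `c`, and semiprimeness gives `a b = b a`.
-/

namespace VecSemiInner

/-! ### Infima, square roots and semi-inner products -/

section Basic

variable {F : Type*}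

lemma vinf_eq [Zero F] [PartialOrder F] {S : Set F} {m : F} (h : IsGLB S m) : vinf S = m := by
  have hex : ∃ m, IsGLB S m := ⟨m, h⟩
  rw [vinf, dif_pos hex]
  exact hex.choose_spec.unique h

lemma SquareRootClosed.exists_sqrt [NonUnitalRing F] [Lattice F]
    (hsqrt : SquareRootClosed F) {a : F} (ha : 0 ≤ a) :
    ∃ s : F, 0 ≤ s ∧ s * s = a :=
  (hsqrt a ha).exists

lemma SquareRootClosed.vsqrt_spec [NonUnitalRing F] [Lattice F]
    (hsqrt : SquareRootClosed F) {a : F} (ha : 0 ≤ a) :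
    0 ≤ vsqrt a ∧ vsqrt a * vsqrt a = a := by
  rw [vsqrt, dif_pos (hsqrt a ha)]
  exact (hsqrt a ha).choose_spec.1

lemma IsSemiprime.eq_zero_of_mul_self [NonUnitalRing F]
    (hsemi : IsSemiprime F) {a : F} (h : a * a = 0) : a = 0 :=
  hsemi a 1 h

lemma IsVectorSemiInnerProduct.smul_sub_self {V F : Type*} [AddCommGroup V]
    [Module ℝ V] [AddCommGroup F] [Lattice F] [Module ℝ F] {T : V → V → F}
    (hT : IsVectorSemiInnerProduct T) (c : ℝ) (x y : V) :
    T (c • x - y) (c • x - y) = (c * c) • T x x - (2 * c) • T x y + T y y := by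
  have hn : c • x - y = c • x + (-1 : ℝ) • y := by module
  rw [hn, hT.add_left, hT.add_right, hT.add_right]
  simp only [← hT.smul_left, ← hT.smul_right, hT.symm y x]
  module

end Basic

/-! ### Positive orthomorphisms of vector lattices -/

section Ortho

variable {F : Type*} [AddCommGroup F] [Lattice F]

lemma posPart_le_iff {a b : F} : a⁺ ≤ b ↔ a ≤ b ∧ 0 ≤ b := sup_le_iff

lemma negPart_le_iff {a b : F} : a⁻ ≤ b ↔ -a ≤ b ∧ 0 ≤ b := sup_le_iff

/-- A positive orthomorphism: a positive additive map that preserves disjointness with every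
element. Homogeneity over `ℝ` is not required: it follows from the Archimedean property. -/
structure IsPosOrtho (R : F →+ F) : Prop where
  nonneg : ∀ a, 0 ≤ a → 0 ≤ R a
  inf_eq_zero : ∀ a b, a ⊓ b = 0 → R a ⊓ b = 0

lemma IsPosOrtho.id : IsPosOrtho (AddMonoidHom.id F) := ⟨fun _ h => h, fun _ _ h => h⟩

lemma IsPosOrtho.map_inf_map_eq_zero {R : F →+ F} (hR : IsPosOrtho R) {a b : F}
    (h : a ⊓ b = 0) : R a ⊓ R b = 0 := by
  rw [inf_comm]
  exact hR.inf_eq_zero _ _ (by rw [inf_comm]; exact hR.inf_eq_zero a b h)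

lemma IsArchimedeanVL.le_of_forall_nat [IsOrderedAddMonoid F] [Module ℝ F]
    (hA : IsArchimedeanVL F) {a b c : F} (hc : 0 ≤ c)
    (h : ∀ n : ℕ, 0 < n → a ≤ b + (n : ℝ)⁻¹ • c) : a ≤ b := by
  have := (hA c hc).2 (show a - b ∈ lowerBounds _ by
    rintro w ⟨n, hn, rfl⟩
    exact sub_le_iff_le_add'.2 (h n hn))
  exact sub_nonpos.1 this

end Ortho

section Lattice

variable {F : Type*} [AddCommGroup F] [Lattice F] [IsOrderedAddMonoid F]

lemma inf_add_le_of_nonneg {a b c : F} (hc : 0 ≤ c) : a ⊓ (b + c) ≤ a ⊓ b + c := by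
  rw [inf_add]
  exact le_inf (inf_le_left.trans (le_add_of_nonneg_right hc)) inf_le_right

lemma inf_add_le_add_inf {a b c : F} (ha : 0 ≤ a) (hb : 0 ≤ b) (hc : 0 ≤ c) :
    a ⊓ (b + c) ≤ a ⊓ b + a ⊓ c := by
  have h : a ⊓ (b + c) - a ⊓ b ≤ a ⊓ c := by
    refine le_inf ?_ ?_
    · exact (sub_le_self _ (le_inf ha hb)).trans inf_le_left
    · exact sub_le_iff_le_add'.2 (inf_add_le_of_nonneg hc)
  exact sub_le_iff_le_add'.1 h

lemma inf_add_eq_zero {a b c : F} (hb : a ⊓ b = 0) (hc : a ⊓ c = 0) : a ⊓ (b + c) = 0 := by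
  have ha : 0 ≤ a := hb ▸ inf_le_left
  have hb' : 0 ≤ b := hb ▸ inf_le_right
  have hc' : 0 ≤ c := hc ▸ inf_le_right
  refine le_antisymm ?_ (le_inf ha (add_nonneg hb' hc'))
  simpa [hb, hc] using inf_add_le_add_inf ha hb' hc'

lemma sup_eq_add_of_inf_eq_zero {a b : F} (h : a ⊓ b = 0) : a ⊔ b = a + b := by
  simpa [h] using inf_add_sup a b

/-- A discrete intermediate value argument: if every point of a chain is covered by `P i` or by
`M i`, and it is only possible to pass from `M i` to `P (i + 1)` inside `e`, then `r` lies below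
the two ends of the chain, up to `e`. -/
lemma le_sup_of_chain {r e : F} {P M : ℕ → F} (n : ℕ) (hr : ∀ i ≤ n, r ≤ P i ⊔ M i)
    (he : ∀ i < n, M i ⊓ P (i + 1) ≤ e) : r ≤ P 0 ⊔ M n ⊔ e := by
  let _ : DistribLattice F := AddCommGroup.toDistribLattice F
  induction n with
  | zero => exact (hr 0 le_rfl).trans le_sup_left
  | succ n ih =>
    have h₁ := ih (fun i hi => hr i (hi.trans n.le_succ)) fun i hi => he i (hi.trans n.lt_succ_self)
    have h₂ := hr (n + 1) le_rfl
    have h₃ := he n n.lt_succ_self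
    calc r ≤ (P 0 ⊔ M n ⊔ e) ⊓ (P (n + 1) ⊔ M (n + 1)) := le_inf h₁ h₂
      _ ≤ P 0 ⊔ M (n + 1) ⊔ e := by
        rw [inf_sup_left, inf_sup_right, inf_sup_right]
        refine sup_le (sup_le (sup_le ?_ ?_) ?_) ?_
        · exact inf_le_left.trans (le_sup_left.trans le_sup_left)
        · exact h₃.trans le_sup_right
        · exact inf_le_left.trans le_sup_right
        · exact inf_le_right.trans (le_sup_right.trans le_sup_left)

namespace IsPosOrtho

variable {R S : F →+ F}

lemma mono (hR : IsPosOrtho R) {a b : F} (h : a ≤ b) : R a ≤ R b := by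
  simpa using hR.nonneg (b - a) (sub_nonneg.2 h)

lemma add (hR : IsPosOrtho R) (hS : IsPosOrtho S) : IsPosOrtho (R + S) where
  nonneg a ha := add_nonneg (hR.nonneg a ha) (hS.nonneg a ha)
  inf_eq_zero a b h := by
    rw [inf_comm]
    exact inf_add_eq_zero (by rw [inf_comm]; exact hR.inf_eq_zero a b h)
      (by rw [inf_comm]; exact hS.inf_eq_zero a b h)

lemma add_nsmul_id (hR : IsPosOrtho R) (N : ℕ) : IsPosOrtho (R + N • AddMonoidHom.id F) := by
  induction N with
  | zero => simpa using hR
  | succ N ih => rw [succ_nsmul, ← add_assoc]; exact ih.add id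

lemma map_inf (hR : IsPosOrtho R) (a b : F) : R (a ⊓ b) = R a ⊓ R b := by
  have h : (a - a ⊓ b) ⊓ (b - a ⊓ b) = 0 := by rw [← inf_sub, sub_self]
  have h' := hR.map_inf_map_eq_zero h
  rw [map_sub, map_sub, ← inf_sub, sub_eq_zero] at h'
  exact h'.symm

lemma map_abs (hR : IsPosOrtho R) (a : F) : R |a| = R a⁺ ⊔ R a⁻ := by
  rw [sup_eq_add_of_inf_eq_zero (hR.map_inf_map_eq_zero (posPart_inf_negPart_eq_zero a)),
    ← map_add, posPart_add_negPart]

lemma abs_map_le (hR : IsPosOrtho R) (a : F) : |R a| ≤ R |a| :=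
  abs_le'.2 ⟨hR.mono (le_abs_self a), by rw [← map_neg]; exact hR.mono (neg_le_abs a)⟩

end IsPosOrtho

end Lattice

/-! ### Archimedean vector lattices -/

section Archimedean

variable {F : Type*} [AddCommGroup F] [Lattice F] [IsOrderedAddMonoid F] [Module ℝ F]
  [PosSMulMono ℝ F]

lemma smul_le_smul_of_le {a : F} {c d : ℝ} (h : c ≤ d) (ha : 0 ≤ a) : c • a ≤ d • a := by
  rw [← sub_nonneg, ← sub_smul]
  exact smul_nonneg (sub_nonneg.2 h) ha

lemma IsArchimedeanVL.map_smul_of_nonneg (hA : IsArchimedeanVL F) (R : F →+ F)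
    (hR : ∀ a, 0 ≤ a → 0 ≤ R a) (c : ℝ) {a : F} (ha : 0 ≤ a) : R (c • a) = c • R a := by
  have mono : ∀ {a b}, a ≤ b → R a ≤ R b := fun {a b} h => by
    simpa using hR (b - a) (sub_nonneg.2 h)
  have hRa := hR a ha
  have key : ∀ c : ℝ, R (c • a) ≤ c • R a := by
    intro c
    refine hA.le_of_forall_nat hRa fun n hn => ?_
    have hn' : (0 : ℝ) < (n : ℝ)⁻¹ := by positivity
    obtain ⟨q, hq₁, hq₂⟩ := exists_rat_btwn (lt_add_of_pos_right c hn')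
    calc R (c • a) ≤ R ((q : ℝ) • a) := mono (smul_le_smul_of_le hq₁.le ha)
      _ = (q : ℝ) • R a := map_ratCast_smul R ℝ ℝ q a
      _ ≤ (c + (n : ℝ)⁻¹) • R a := smul_le_smul_of_le hq₂.le hRa
      _ = _ := add_smul _ _ _
  refine le_antisymm (key c) ?_
  have := key (-c)
  rw [neg_smul, neg_smul, map_neg] at this
  exact neg_le_neg_iff.1 this

lemma IsArchimedeanVL.map_smul (hA : IsArchimedeanVL F) (R : F →+ F)
    (hR : ∀ a, 0 ≤ a → 0 ≤ R a) (c : ℝ) (a : F) : R (c • a) = c • R a := by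
  rw [← posPart_sub_negPart a, smul_sub, map_sub, map_sub, smul_sub,
    hA.map_smul_of_nonneg R hR c (posPart_nonneg a),
    hA.map_smul_of_nonneg R hR c (negPart_nonneg a)]

/-- An intermediate value theorem: if `p` moves at a bounded rate on `[α, β]`, and `K |p μ|` stays
above `r`, then `p` cannot change its sign on `r`, which therefore lies below the positive part of
`p α` and the negative part of `p β`. -/
lemma le_sup_of_forall_le_map_abs (hA : IsArchimedeanVL F) {K : F →+ F} (hK : IsPosOrtho K)
    {r c : F} {p : ℝ → F} {α β : ℝ} (hαβ : α ≤ β) (hc : 0 ≤ c)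
    (hp : ∀ μ ν, α ≤ μ → μ ≤ ν → ν ≤ β → p ν ≤ p μ + (ν - μ) • c)
    (hr : ∀ μ, α ≤ μ → μ ≤ β → r ≤ K |p μ|) : r ≤ K (p α)⁺ ⊔ K (p β)⁻ := by
  have hKc : 0 ≤ K ((β - α) • c) := hK.nonneg _ (smul_nonneg (sub_nonneg.2 hαβ) hc)
  refine hA.le_of_forall_nat hKc fun n hn => ?_
  have hn' : (0 : ℝ) < n := Nat.cast_pos.2 hn
  have hd : 0 ≤ (β - α) / n := div_nonneg (sub_nonneg.2 hαβ) hn'.le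
  set g : ℕ → ℝ := fun i => α + i * ((β - α) / n) with hg
  have hg0 : g 0 = α := by simp [hg]
  have hgn : g n = β := by simp only [hg]; field_simp; ring
  have hga : ∀ i, α ≤ g i := fun i => le_add_of_nonneg_right (by positivity)
  have hgb : ∀ i ≤ n, g i ≤ β := fun i hi => by
    rw [← hgn]
    have : (i : ℝ) ≤ n := Nat.cast_le.2 hi
    simp only [hg]; gcongr
  have hgs : ∀ i, g (i + 1) - g i = (β - α) / n := fun i => by simp only [hg]; push_cast; ring
  have hchain := le_sup_of_chain (r := r) (e := K (((β - α) / n) • c))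
    (P := fun i => K (p (g i))⁺) (M := fun i => K (p (g i))⁻) n
    (fun i hi => by rw [← hK.map_abs]; exact hr _ (hga i) (hgb i hi))
    (fun i hi => by
      rw [← hK.map_inf]
      refine hK.mono ?_
      have hpi := hp (g i) (g (i + 1)) (hga i) (by linarith [hgs i]) (hgb _ hi)
      rw [hgs] at hpi
      have hdc : 0 ≤ ((β - α) / n) • c := smul_nonneg hd hc
      have h₁ : (p (g (i + 1)))⁺ ≤ (p (g i))⁺ + ((β - α) / n) • c := by
        refine posPart_le_iff.2 ⟨hpi.trans (by gcongr; exact le_posPart _), ?_⟩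
        exact add_nonneg (posPart_nonneg _) hdc
      calc _ ≤ (p (g i))⁻ ⊓ ((p (g i))⁺ + ((β - α) / n) • c) := inf_le_inf_left _ h₁
        _ ≤ (p (g i))⁻ ⊓ (p (g i))⁺ + ((β - α) / n) • c := inf_add_le_of_nonneg hdc
        _ = _ := by rw [inf_comm, posPart_inf_negPart_eq_zero, zero_add])
  simp only [hg0, hgn] at hchain
  have hKn : K (((β - α) / n) • c) = (n : ℝ)⁻¹ • K ((β - α) • c) := by
    rw [← hA.map_smul K hK.nonneg, smul_smul, inv_mul_eq_div]
  rw [hKn] at hchain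
  refine hchain.trans (sup_le (le_add_of_nonneg_right (smul_nonneg (by positivity) hKc)) ?_)
  exact le_add_of_nonneg_left ((hK.nonneg _ (posPart_nonneg _)).trans le_sup_left)

/-- Positive orthomorphisms of an Archimedean vector lattice commute. Where `R a` is close to `μ a`
and `S a` is close to `ν a`, both composites are close to `μ ν a`; letting `μ` and `ν` range over
`[0, N]` covers all but the parts on which `R a` or `S a` exceeds `N a`, and these shrink with `N`. -/
lemma IsPosOrtho.map_comm (hA : IsArchimedeanVL F) {R S : F →+ F} (hR : IsPosOrtho R)
    (hS : IsPosOrtho S) {a : F} (ha : 0 ≤ a) : S (R a) = R (S a) := by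
  set r := |S (R a) - R (S a)| with hr
  have hr0 : 0 ≤ r := abs_nonneg _
  have hRa := hR.nonneg a ha
  have hSa := hS.nonneg a ha
  have hsmul : ∀ (K : F →+ F), IsPosOrtho K → ∀ (c : ℝ) b, K (c • b) = c • K b :=
    fun K hK => hA.map_smul K hK.nonneg
  have hK : ∀ (K : F →+ F) (N : ℕ) (b : F),
      (K + N • AddMonoidHom.id F) b = K b + (N : ℝ) • b := by
    intro K N b; simp [Nat.cast_smul_eq_nsmul]
  -- With `v = μ a - R a` and `w = ν a - S a`, the difference of the composites is
  -- `(R - μ) w - (S - ν) v`, whose terms are small where `w`, respectively `v`, is small.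
  have hbound : ∀ N : ℕ, ∀ μ ν : ℝ, 0 ≤ μ → μ ≤ N → 0 ≤ ν → ν ≤ N →
      r ≤ (S + N • AddMonoidHom.id F) |μ • a - R a| +
        (R + N • AddMonoidHom.id F) |ν • a - S a| := by
    intro N μ ν hμ hμN hν hνN
    have hid : S (R a) - R (S a) = (R (ν • a - S a) + ν • (μ • a - R a)) -
        (S (μ • a - R a) + μ • (ν • a - S a)) := by
      rw [map_sub, map_sub, hsmul R hR, hsmul S hS]
      module
    have habs : ∀ (c : F) (ξ : ℝ), 0 ≤ ξ → ξ ≤ N →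
        |ξ • c| ≤ (N : ℝ) • |c| := by
      intro c ξ h0 h1
      refine (abs_le'.2 ⟨?_, ?_⟩ : |ξ • c| ≤ ξ • |c|).trans (smul_le_smul_of_le h1 (abs_nonneg c))
      · exact smul_le_smul_of_nonneg_left (le_abs_self c) h0
      · rw [← smul_neg]; exact smul_le_smul_of_nonneg_left (neg_le_abs c) h0
    rw [hr, hid, hK, hK]
    set v := μ • a - R a
    set w := ν • a - S a
    calc |R w + ν • v - (S v + μ • w)| ≤ |R w + ν • v| + |S v + μ • w| := by
          rw [sub_eq_add_neg, ← abs_neg (S v + μ • w)]; exact abs_add_le _ _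
      _ ≤ (|R w| + |ν • v|) + (|S v| + |μ • w|) := add_le_add (abs_add_le _ _) (abs_add_le _ _)
      _ ≤ (R |w| + (N : ℝ) • |v|) + (S |v| + (N : ℝ) • |w|) := by
          refine add_le_add (add_le_add (hR.abs_map_le w) ?_) (add_le_add (hS.abs_map_le v) ?_)
          · exact habs v ν hν hνN
          · exact habs w μ hμ hμN
      _ = _ := by abel
  have htail : ∀ N : ℕ, r ≤ (S + N • AddMonoidHom.id F) ((N : ℝ) • a - R a)⁻ +
        (R + N • AddMonoidHom.id F) ((N : ℝ) • a - S a)⁻ := by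
    intro N
    have hKS := hS.add_nsmul_id N
    have hKR := hR.add_nsmul_id N
    have hN : (0 : ℝ) ≤ N := Nat.cast_nonneg N
    have hrate : ∀ b : F, ∀ μ ν : ℝ, 0 ≤ μ → μ ≤ ν → ν ≤ N →
        ν • a - b ≤ μ • a - b + (ν - μ) • a := fun b μ ν _ _ _ => le_of_eq (by module)
    have hends : ∀ (K : F →+ F), IsPosOrtho K → ∀ b : F, 0 ≤ b →
        K ((0 : ℝ) • a - b)⁺ ⊔ K ((N : ℝ) • a - b)⁻ = K ((N : ℝ) • a - b)⁻ := by
      intro K hK b hb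
      rw [posPart_eq_zero.2 (by simpa using hb), map_zero]
      exact sup_eq_right.2 (hK.nonneg _ (negPart_nonneg _))
    -- the intermediate value theorem is applied in `μ` for fixed `ν`, and then in `ν`
    have h₁ : ∀ ν : ℝ, 0 ≤ ν → ν ≤ N →
        r - (S + N • AddMonoidHom.id F) ((N : ℝ) • a - R a)⁻ ≤
          (R + N • AddMonoidHom.id F) |ν • a - S a| := by
      intro ν hν hνN
      have := le_sup_of_forall_le_map_abs hA hKS (p := fun μ => μ • a - R a)
        (r := r - (R + N • AddMonoidHom.id F) |ν • a - S a|) hN ha (hrate _)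
        fun μ h0 h1 => sub_le_iff_le_add.2 (hbound N μ ν h0 h1 hν hνN)
      rw [hends _ hKS _ hRa] at this
      exact sub_le_comm.1 this
    have := le_sup_of_forall_le_map_abs hA hKR (p := fun ν => ν • a - S a) hN ha (hrate _) h₁
    rw [hends _ hKR _ hSa] at this
    exact sub_le_iff_le_add'.1 this
  -- `(N a - b)⁻` lives where `N a ≤ b`, so that it meets `a` in at most `b / N`
  have hsmall : ∀ (K : F →+ F), IsPosOrtho K → ∀ b : F, 0 ≤ b → ∀ N : ℕ, 0 < N →
      a ⊓ K ((N : ℝ) • a - b)⁻ ≤ (N : ℝ)⁻¹ • b := by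
    intro K hK b hb N hN
    have hN' : (1 : ℝ) ≤ N := Nat.one_le_cast.2 hN
    set q := (N : ℝ) • a - b
    have haq : a ≤ q⁺ + (N : ℝ)⁻¹ • b := by
      have h₁ : a = (N : ℝ)⁻¹ • q + (N : ℝ)⁻¹ • b := by
        rw [← smul_add, sub_add_cancel, smul_smul, inv_mul_cancel₀ (by positivity), one_smul]
      have h₂ : (N : ℝ)⁻¹ • q ≤ q⁺ :=
        calc (N : ℝ)⁻¹ • q ≤ (N : ℝ)⁻¹ • q⁺ :=
              smul_le_smul_of_nonneg_left (le_posPart q) (by positivity)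
          _ ≤ (1 : ℝ) • q⁺ := smul_le_smul_of_le (inv_le_one_of_one_le₀ hN') (posPart_nonneg q)
          _ = q⁺ := one_smul _ _
      calc a = _ := h₁
        _ ≤ _ := by gcongr
    calc a ⊓ K q⁻ ≤ K q⁻ ⊓ (q⁺ + (N : ℝ)⁻¹ • b) := by
          rw [inf_comm]; exact inf_le_inf_left _ haq
      _ ≤ K q⁻ ⊓ q⁺ + (N : ℝ)⁻¹ • b := inf_add_le_of_nonneg (smul_nonneg (by positivity) hb)
      _ = _ := by
        rw [hK.inf_eq_zero _ _ (by rw [inf_comm]; exact posPart_inf_negPart_eq_zero q), zero_add]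
  have hra : a ⊓ r = 0 := by
    refine le_antisymm (hA.le_of_forall_nat (add_nonneg hRa hSa) fun N hN => ?_) (le_inf ha hr0)
    have hKS := hS.add_nsmul_id N
    have hKR := hR.add_nsmul_id N
    calc a ⊓ r ≤ _ := inf_le_inf_left a (htail N)
      _ ≤ _ := inf_add_le_add_inf ha (hKS.nonneg _ (negPart_nonneg _))
          (hKR.nonneg _ (negPart_nonneg _))
      _ ≤ (N : ℝ)⁻¹ • R a + (N : ℝ)⁻¹ • S a :=
          add_le_add (hsmall _ hKS _ hRa N hN) (hsmall _ hKR _ hSa N hN)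
      _ = _ := by rw [zero_add, smul_add]
  -- `r` lies in the band generated by `a`, hence is disjoint from itself
  have h₁ : r ⊓ S (R a) = 0 := by
    rw [inf_comm]; exact hS.inf_eq_zero _ _ (hR.inf_eq_zero _ _ hra)
  have h₂ : r ⊓ R (S a) = 0 := by
    rw [inf_comm]; exact hR.inf_eq_zero _ _ (hS.inf_eq_zero _ _ hra)
  have h₃ : r ≤ S (R a) + R (S a) := by
    have h₄ := hS.nonneg _ hRa
    have h₅ := hR.nonneg _ hSa
    exact abs_le'.2 ⟨(sub_le_self _ h₅).trans (le_add_of_nonneg_right h₅),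
      by rw [neg_sub]; exact (sub_le_self _ h₄).trans (le_add_of_nonneg_left h₄)⟩
  have h₆ : r = 0 := by rw [← inf_eq_left.2 h₃]; exact inf_add_eq_zero h₁ h₂
  have h₇ : ∀ {b}, b ≤ r → b ≤ 0 := fun hb => hb.trans_eq h₆
  exact le_antisymm (sub_nonpos.1 (h₇ (le_abs_self _)))
    (sub_nonpos.1 (h₇ (by rw [← neg_sub]; exact neg_le_abs _)))

/-- For positive `a` and `b`, the elements `|μ a - μ⁻¹ b|` have infimum `0`. -/
lemma nonpos_of_forall_le_abs_smul_sub (hA : IsArchimedeanVL F) {r a b : F} (ha : 0 ≤ a)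
    (hb : 0 ≤ b) (h : ∀ μ : ℝ, 0 < μ → r ≤ |μ • a - μ⁻¹ • b|) : r ≤ 0 := by
  refine hA.le_of_forall_nat (add_nonneg ha hb) fun N hN => ?_
  have hN' : (1 : ℝ) ≤ N := Nat.one_le_cast.2 hN
  have hN0 : (0 : ℝ) < N := one_pos.trans_le hN'
  have hNi : (0 : ℝ) < (N : ℝ)⁻¹ := inv_pos.2 hN0
  have hNa : 0 ≤ (N : ℝ)⁻¹ • a := smul_nonneg hNi.le ha
  have hNb : 0 ≤ (N : ℝ)⁻¹ • b := smul_nonneg hNi.le hb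
  have := le_sup_of_forall_le_map_abs hA (F := F) IsPosOrtho.id (r := r)
    (p := fun μ => μ • a - μ⁻¹ • b) (c := a + ((N : ℝ) * N) • b)
    ((inv_le_one_of_one_le₀ hN').trans hN')
    (add_nonneg ha (smul_nonneg (by positivity) hb))
    (fun μ ν hμ hμν hν => by
      have hμ0 : 0 < μ := hNi.trans_le hμ
      have hν0 : 0 < ν := hμ0.trans_le hμν
      have h₁ : μ⁻¹ ≤ N := inv_le_of_inv_le₀ hN0 hμ
      have h₂ : ν⁻¹ ≤ N := inv_le_of_inv_le₀ hN0 (hμ.trans hμν)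
      have h₃ : μ⁻¹ - ν⁻¹ ≤ (ν - μ) * (N * N) := by
        have : μ⁻¹ - ν⁻¹ = (ν - μ) * (μ⁻¹ * ν⁻¹) := by field_simp
        rw [this]
        have := sub_nonneg.2 hμν
        gcongr
      have h₄ := smul_le_smul_of_le h₃ hb
      calc ν • a - ν⁻¹ • b = μ • a - μ⁻¹ • b + ((ν - μ) • a + (μ⁻¹ - ν⁻¹) • b) := by module
        _ ≤ μ • a - μ⁻¹ • b + ((ν - μ) • a + ((ν - μ) * (N * N)) • b) := by gcongr
        _ = _ := by module)
    (fun μ hμ _ => h μ (hNi.trans_le hμ))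
  rw [zero_add, smul_add]
  refine this.trans (sup_le ?_ ?_)
  · refine posPart_le_iff.2 ⟨?_, add_nonneg hNa hNb⟩
    rw [inv_inv]
    exact (sub_le_self _ (smul_nonneg hN0.le hb)).trans (le_add_of_nonneg_right hNb)
  · refine negPart_le_iff.2 ⟨?_, add_nonneg hNa hNb⟩
    rw [neg_sub]
    exact (sub_le_self _ (smul_nonneg hN0.le ha)).trans (le_add_of_nonneg_left hNa)

end Archimedean

/-! ### Archimedean semiprime `f`-algebras -/

section FAlgebra

lemma IsFAlgebra.isPosOrtho_mulRight {F : Type*} [NonUnitalRing F] [Lattice F]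
    (hF : IsFAlgebra F) {b : F} (hb : 0 ≤ b) :
    IsPosOrtho (AddMonoidHom.mulRight b) :=
  ⟨fun a ha => hF.mul_nonneg a b ha hb, fun a c h => (hF.inf_mul a c h b hb).1⟩

variable {F : Type*} [NonUnitalRing F] [Lattice F] [IsOrderedAddMonoid F] [Module ℝ F]
  [PosSMulMono ℝ F]

/-- Right multiplications by positive elements are orthomorphisms, so that they commute with each
other; semiprimeness turns `c * (a * b) = c * (b * a)` into `a * b = b * a`. -/
lemma IsFAlgebra.mul_comm (hF : IsFAlgebra F) (hA : IsArchimedeanVL F) (hsemi : IsSemiprime F)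
    (a b : F) : a * b = b * a := by
  have key : ∀ a b c : F, 0 ≤ a → 0 ≤ b → 0 ≤ c → c * (a * b - b * a) = 0 := by
    intro a b c ha hb hc
    have := (hF.isPosOrtho_mulRight ha).map_comm hA (hF.isPosOrtho_mulRight hb) hc
    simp only [AddMonoidHom.mulRight_apply, mul_assoc] at this
    rw [mul_sub, this, sub_self]
  have pos : ∀ a b : F, 0 ≤ a → 0 ≤ b → a * b = b * a := by
    intro a b ha hb
    refine sub_eq_zero.1 (hsemi.eq_zero_of_mul_self ?_)
    rw [sub_mul, key a b _ ha hb (hF.mul_nonneg a b ha hb),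
      key a b _ ha hb (hF.mul_nonneg b a hb ha), sub_self]
  rw [← posPart_sub_negPart a, ← posPart_sub_negPart b]
  simp only [mul_sub, sub_mul]
  rw [pos a⁺ b⁺ (posPart_nonneg _) (posPart_nonneg _),
    pos a⁺ b⁻ (posPart_nonneg _) (negPart_nonneg _),
    pos a⁻ b⁺ (negPart_nonneg _) (posPart_nonneg _),
    pos a⁻ b⁻ (negPart_nonneg _) (negPart_nonneg _)]
  abel

/-- The multiplication is not assumed to be real bilinear; it is by the Archimedean property. -/
lemma IsFAlgebra.smul_mul (hF : IsFAlgebra F) (hA : IsArchimedeanVL F) (c : ℝ) (a b : F) :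
    (c • a) * b = c • (a * b) := by
  have h : ∀ b : F, 0 ≤ b → (c • a) * b = c • (a * b) := fun b hb =>
    hA.map_smul (AddMonoidHom.mulRight b) (hF.isPosOrtho_mulRight hb).nonneg c a
  rw [← posPart_sub_negPart b, mul_sub, mul_sub, smul_sub, h _ (posPart_nonneg b),
    h _ (negPart_nonneg b)]

lemma IsFAlgebra.mul_smul (hF : IsFAlgebra F) (hA : IsArchimedeanVL F) (hsemi : IsSemiprime F)
    (c : ℝ) (a b : F) : a * (c • b) = c • (a * b) := by
  rw [hF.mul_comm hA hsemi, hF.smul_mul hA, hF.mul_comm hA hsemi b a]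

lemma IsFAlgebra.mul_eq_zero_of_inf (hF : IsFAlgebra F) (hA : IsArchimedeanVL F)
    (hsemi : IsSemiprime F) {a b : F} (h : a ⊓ b = 0) : a * b = 0 := by
  have ha : 0 ≤ a := h ▸ inf_le_left
  have hb : 0 ≤ b := h ▸ inf_le_right
  have h₁ := (hF.inf_mul _ _ (hF.inf_mul _ _ h b hb).1 a ha).2
  rwa [hF.mul_comm hA hsemi b a, inf_idem] at h₁

lemma IsFAlgebra.posPart_mul_negPart (hF : IsFAlgebra F) (hA : IsArchimedeanVL F)
    (hsemi : IsSemiprime F) (a : F) : a⁺ * a⁻ = 0 :=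
  hF.mul_eq_zero_of_inf hA hsemi (posPart_inf_negPart_eq_zero a)

lemma IsFAlgebra.abs_mul_abs_self (hF : IsFAlgebra F) (hA : IsArchimedeanVL F)
    (hsemi : IsSemiprime F) (a : F) : |a| * |a| = a * a := by
  have h := hF.posPart_mul_negPart hA hsemi a
  have h' := hF.mul_comm hA hsemi a⁺ a⁻
  rw [h] at h'
  conv_rhs => rw [← posPart_sub_negPart a]
  rw [← posPart_add_negPart]
  simp only [mul_add, add_mul, mul_sub, sub_mul, h, ← h']
  abel

lemma IsFAlgebra.mul_self_nonneg (hF : IsFAlgebra F) (hA : IsArchimedeanVL F)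
    (hsemi : IsSemiprime F) (a : F) : 0 ≤ a * a := by
  rw [← hF.abs_mul_abs_self hA hsemi]
  exact hF.mul_nonneg _ _ (abs_nonneg a) (abs_nonneg a)

/-- With `p = (a - b)⁺`, the hypothesis gives `p² (a + b) ≤ 0`, while `p ≤ a + b`; hence `p³ = 0`. -/
lemma IsFAlgebra.le_of_mul_self_le (hF : IsFAlgebra F) (hA : IsArchimedeanVL F)
    (hsemi : IsSemiprime F) {a b : F} (ha : 0 ≤ a) (hb : 0 ≤ b) (h : a * a ≤ b * b) : a ≤ b := by
  set p := (a - b)⁺ with hp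
  have hp0 : 0 ≤ p := posPart_nonneg _
  have hpa : p ≤ a + b := posPart_le_iff.2
    ⟨(sub_le_self _ hb).trans (le_add_of_nonneg_right hb), add_nonneg ha hb⟩
  have hpp : p * (a - b) = p * p := by
    conv_lhs => rw [← posPart_sub_negPart (a - b)]
    rw [mul_sub, ← hp, hF.posPart_mul_negPart hA hsemi, sub_zero]
  have h₁ : p * (b * b - a * a) = - (p * p * (a + b)) := by
    rw [← hpp, mul_assoc, ← mul_neg]
    congr 1
    simp only [sub_mul, mul_add]
    rw [hF.mul_comm hA hsemi b a]
    abel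
  have h₂ : 0 ≤ p * (b * b - a * a) := hF.mul_nonneg _ _ hp0 (sub_nonneg.2 h)
  have h₃ : 0 ≤ p * p * (a + b - p) :=
    hF.mul_nonneg _ _ (hF.mul_nonneg _ _ hp0 hp0) (sub_nonneg.2 hpa)
  have h₄ : p * p * p = 0 := by
    refine le_antisymm ?_ (hF.mul_nonneg _ _ (hF.mul_nonneg _ _ hp0 hp0) hp0)
    rw [h₁, neg_nonneg] at h₂
    rw [mul_sub, sub_nonneg] at h₃
    exact h₃.trans h₂
  have h₅ : p = 0 := hsemi p 2 (by simpa [mul_assoc] using h₄)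
  exact sub_nonpos.1 (posPart_eq_zero.1 h₅)

/-! ### The geometric mean -/

/-- For `a = s²` and `b = t²`, one has `μ² a + μ⁻² b = (μ s - μ⁻¹ t)² + 2 s t`, and the squares on
the right have infimum `0`. -/
lemma IsFAlgebra.isGLB_gmSet (hF : IsFAlgebra F) (hA : IsArchimedeanVL F) (hsemi : IsSemiprime F)
    (hsqrt : SquareRootClosed F) {s t : F} (hs : 0 ≤ s) (ht : 0 ≤ t) :
    IsGLB (gmSet (s * s) (t * t)) ((2 : ℝ) • (s * t)) := by
  have hid : ∀ μ : ℝ, 0 < μ → (μ * μ) • (s * s) + (μ * μ)⁻¹ • (t * t) =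
      (μ • s - μ⁻¹ • t) * (μ • s - μ⁻¹ • t) + (2 : ℝ) • (s * t) := by
    intro μ hμ
    simp only [mul_sub, sub_mul, hF.smul_mul hA, hF.mul_smul hA hsemi, hF.mul_comm hA hsemi t s]
    match_scalars <;> field_simp
    ring
  refine ⟨?_, fun w hw => ?_⟩
  · rintro _ ⟨θ, hθ, rfl⟩
    have h := hid (√θ) (Real.sqrt_pos.2 hθ)
    rw [Real.mul_self_sqrt hθ.le] at h
    rw [h]
    exact le_add_of_nonneg_left (hF.mul_self_nonneg hA hsemi _)
  · have hle : ∀ μ : ℝ, 0 < μ →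
        (w - (2 : ℝ) • (s * t))⁺ ≤ (μ • s - μ⁻¹ • t) * (μ • s - μ⁻¹ • t) := by
      intro μ hμ
      refine posPart_le_iff.2 ⟨sub_le_iff_le_add.2 ?_, hF.mul_self_nonneg hA hsemi _⟩
      rw [← hid μ hμ]
      exact hw ⟨μ * μ, mul_pos hμ hμ, rfl⟩
    obtain ⟨r, ⟨hr0, hr⟩, -⟩ := hsqrt _ (posPart_nonneg (w - (2 : ℝ) • (s * t)))
    have hr' : r = 0 := by
      refine le_antisymm (nonpos_of_forall_le_abs_smul_sub hA hs ht fun μ hμ => ?_) hr0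
      refine hF.le_of_mul_self_le hA hsemi hr0 (abs_nonneg _) ?_
      rw [hr, hF.abs_mul_abs_self hA hsemi]
      exact hle μ hμ
    rw [hr', mul_zero] at hr
    exact sub_nonpos.1 (posPart_eq_zero.1 hr.symm)

lemma IsFAlgebra.geometricMeanClosed (hF : IsFAlgebra F) (hA : IsArchimedeanVL F)
    (hsemi : IsSemiprime F) (hsqrt : SquareRootClosed F) : GeometricMeanClosed F := by
  intro a b ha hb
  obtain ⟨s, hs, rfl⟩ := hsqrt.exists_sqrt ha
  obtain ⟨t, ht, rfl⟩ := hsqrt.exists_sqrt hb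
  exact ⟨_, hF.isGLB_gmSet hA hsemi hsqrt hs ht⟩

lemma IsFAlgebra.gmean_spec (hF : IsFAlgebra F) (hA : IsArchimedeanVL F)
    (hsemi : IsSemiprime F) (hsqrt : SquareRootClosed F) {a b : F} (ha : 0 ≤ a) (hb : 0 ≤ b) :
    0 ≤ gmean a b ∧ gmean a b * gmean a b = a * b := by
  obtain ⟨s, hs, rfl⟩ := hsqrt.exists_sqrt ha
  obtain ⟨t, ht, rfl⟩ := hsqrt.exists_sqrt hb
  rw [gmean, vinf_eq (hF.isGLB_gmSet hA hsemi hsqrt hs ht), smul_smul,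
    inv_mul_cancel₀ two_ne_zero, one_smul]
  refine ⟨hF.mul_nonneg s t hs ht, ?_⟩
  rw [mul_assoc, ← mul_assoc t, hF.mul_comm hA hsemi t s]
  simp only [mul_assoc]

/-! ### The semi-norm and the sharpened triangle inequality -/

variable {V : Type*} [AddCommGroup V] [Module ℝ V]

/-- The sign of `c` splits the defining set into two translates, by `-2 T(x,y) u` and by
`2 T(x,y) u`, of the set whose infimum is twice the geometric mean of `T(x,x) u` and `T(y,y) u`. -/
lemma IsFAlgebra.isGLB_defectSet (hF : IsFAlgebra F) (hA : IsArchimedeanVL F)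
    (hsemi : IsSemiprime F) (hsqrt : SquareRootClosed F) {T : V → V → F}
    (hT : IsVectorSemiInnerProduct T) {u : F} (hu : 0 ≤ u) (x y : V) :
    IsGLB (defectSet T u x y)
      ((2 : ℝ) • (vnorm T u x * vnorm T u y) - (2 : ℝ) • |T x y * u|) := by
  have hn : ∀ z, 0 ≤ vnorm T u z ∧ vnorm T u z * vnorm T u z = T z z * u := fun z =>
    hF.gmean_spec hA hsemi hsqrt (hT.nonneg z) hu
  have hglb := hF.isGLB_gmSet hA hsemi hsqrt (hn x).1 (hn y).1
  rw [(hn x).2, (hn y).2] at hglb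
  have hval : ∀ c : ℝ, vnorm T u (c • x - y) * vnorm T u (c • x - y) =
      (c * c) • (T x x * u) - (2 * c) • (T x y * u) + T y y * u := by
    intro c
    rw [(hn _).2, hT.smul_sub_self]
    simp only [add_mul, sub_mul, hF.smul_mul hA]
  have hpos : ∀ c : ℝ, 0 < c →
      |c|⁻¹ • (vnorm T u (c • x - y) * vnorm T u (c • x - y)) =
        c • (T x x * u) + c⁻¹ • (T y y * u) - (2 : ℝ) • (T x y * u) := by
    intro c hc
    rw [hval, abs_of_pos hc]
    match_scalars <;> field_simp
  have hneg : ∀ c : ℝ, 0 < c →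
      |-c|⁻¹ • (vnorm T u ((-c) • x - y) * vnorm T u ((-c) • x - y)) =
        c • (T x x * u) + c⁻¹ • (T y y * u) + (2 : ℝ) • (T x y * u) := by
    intro c hc
    rw [hval, abs_neg, abs_of_pos hc]
    match_scalars <;> field_simp
  refine ⟨?_, fun w hw => ?_⟩
  · rintro _ ⟨c, hc, rfl⟩
    rcases hc.lt_or_gt with hc | hc
    · have hc' : 0 < -c := neg_pos.2 hc
      have h := hneg (-c) hc'
      rw [neg_neg] at h
      rw [h, sub_eq_add_neg, ← smul_neg]
      refine add_le_add (hglb.1 ⟨-c, hc', rfl⟩) (smul_le_smul_of_nonneg_left ?_ two_pos.le)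
      exact neg_le.1 (neg_le_abs _)
    · rw [hpos c hc]
      exact sub_le_sub (hglb.1 ⟨c, hc, rfl⟩)
        (smul_le_smul_of_nonneg_left (le_abs_self _) two_pos.le)
  · have h₁ : w + (2 : ℝ) • (T x y * u) ≤ (2 : ℝ) • (vnorm T u x * vnorm T u y) := by
      refine hglb.2 ?_
      rintro _ ⟨c, hc, rfl⟩
      rw [← le_sub_iff_add_le, ← hpos c hc]
      exact hw ⟨c, hc.ne', rfl⟩
    have h₂ : w - (2 : ℝ) • (T x y * u) ≤ (2 : ℝ) • (vnorm T u x * vnorm T u y) := by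
      refine hglb.2 ?_
      rintro _ ⟨c, hc, rfl⟩
      rw [sub_le_iff_le_add, ← hneg c hc]
      exact hw ⟨-c, (neg_neg_of_pos hc).ne, rfl⟩
    set G := (2 : ℝ) • (vnorm T u x * vnorm T u y)
    have h₃ : |T x y * u| ≤ (2 : ℝ)⁻¹ • (G - w) := by
      have e : T x y * u = (2 : ℝ)⁻¹ • ((2 : ℝ) • (T x y * u)) := by
        rw [smul_smul, inv_mul_cancel₀ two_ne_zero, one_smul]
      refine abs_le'.2 ⟨?_, ?_⟩
      · rw [e]
        exact smul_le_smul_of_nonneg_left (le_sub_iff_add_le'.2 h₁) (by positivity)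
      · rw [e, ← smul_neg]
        refine smul_le_smul_of_nonneg_left (le_sub_iff_add_le'.2 ?_) (by positivity)
        rwa [← sub_eq_add_neg]
    have h₄ := smul_le_smul_of_nonneg_left h₃ (two_pos (α := ℝ)).le
    rw [smul_smul, mul_inv_cancel₀ two_ne_zero, one_smul] at h₄
    exact le_sub_comm.1 h₄

end FAlgebra

end VecSemiInner


theorem theorem3p4 {V : Type*} [AddCommGroup V] [Module ℝ V]
    {F : Type*} [NonUnitalRing F] [Lattice F] [IsOrderedAddMonoid F] [Module ℝ F]
    [PosSMulMono ℝ F]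
    (hArch : VecSemiInner.IsArchimedeanVL F) (hF : VecSemiInner.IsFAlgebra F)
    (hsemi : VecSemiInner.IsSemiprime F) (hsqrt : VecSemiInner.SquareRootClosed F)
    (T : V → V → F) (hT : VecSemiInner.IsVectorSemiInnerProduct T)
    (u : F) (hu : 0 ≤ u) (x y : V) :
    -- all infima and square roots in the statement exist
    VecSemiInner.GeometricMeanClosed F ∧
    (∃ m : F, IsGLB (VecSemiInner.defectSet T u x y) m) ∧
    0 ≤ VecSemiInner.radicand T u x y ∧
    -- the two inequalities
    VecSemiInner.vnorm T u (x + y) ≤ VecSemiInner.vsqrt (VecSemiInner.radicand T u x y) ∧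
    VecSemiInner.vsqrt (VecSemiInner.radicand T u x y)
      ≤ VecSemiInner.vnorm T u x + VecSemiInner.vnorm T u y ∧
    -- the equality condition
    (VecSemiInner.vnorm T u (x + y) = VecSemiInner.vsqrt (VecSemiInner.radicand T u x y) ↔
      0 ≤ T x y * u) := by
  have hn : ∀ z, 0 ≤ VecSemiInner.vnorm T u z ∧
      VecSemiInner.vnorm T u z * VecSemiInner.vnorm T u z = T z z * u := fun z =>
    hF.gmean_spec hArch hsemi hsqrt (hT.nonneg z) hu
  have hglb := hF.isGLB_defectSet hArch hsemi hsqrt hT hu x y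
  have hdef : 0 ≤ VecSemiInner.vinf (VecSemiInner.defectSet T u x y) := by
    rw [VecSemiInner.vinf_eq hglb]
    refine hglb.2 ?_
    rintro _ ⟨c, -, rfl⟩
    exact smul_nonneg (by positivity) (hF.mul_nonneg _ _ (hn _).1 (hn _).1)
  have hrad : VecSemiInner.radicand T u x y =
      T x x * u + T y y * u + (2 : ℝ) • |T x y * u| := by
    rw [VecSemiInner.radicand, VecSemiInner.vinf_eq hglb, mul_add, add_mul, add_mul,
      (hn x).2, (hn y).2, hF.mul_comm hArch hsemi (VecSemiInner.vnorm T u y)]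
    module
  have hsum : VecSemiInner.vnorm T u (x + y) * VecSemiInner.vnorm T u (x + y) =
      T x x * u + T y y * u + (2 : ℝ) • (T x y * u) := by
    rw [(hn _).2, hT.add_left, hT.add_right, hT.add_right, hT.symm y x]
    simp only [add_mul]
    module
  have hrad0 : 0 ≤ VecSemiInner.radicand T u x y := by
    rw [hrad]
    exact add_nonneg (add_nonneg (hF.mul_nonneg _ _ (hT.nonneg x) hu)
      (hF.mul_nonneg _ _ (hT.nonneg y) hu)) (smul_nonneg two_pos.le (abs_nonneg _))
  obtain ⟨hs0, hs⟩ := hsqrt.vsqrt_spec hrad0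
  have hle : VecSemiInner.vnorm T u (x + y) * VecSemiInner.vnorm T u (x + y) ≤
      VecSemiInner.radicand T u x y := by
    rw [hsum, hrad]
    gcongr
    exact le_abs_self _
  refine ⟨hF.geometricMeanClosed hArch hsemi hsqrt, ⟨_, hglb⟩, hrad0, ?_, ?_,
    fun h => ?_, fun h => ?_⟩
  · exact hF.le_of_mul_self_le hArch hsemi (hn _).1 hs0 (hle.trans_eq hs.symm)
  · refine hF.le_of_mul_self_le hArch hsemi hs0 (add_nonneg (hn x).1 (hn y).1) ?_
    rw [hs]
    exact sub_le_self _ hdef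
  · have h₁ : (2 : ℝ) • (T x y * u) = (2 : ℝ) • |T x y * u| := by
      rw [← h, hsum, hrad] at hs
      exact add_left_cancel hs
    rw [smul_right_injective F (two_ne_zero (α := ℝ)) h₁]
    exact abs_nonneg _
  · refine le_antisymm (hF.le_of_mul_self_le hArch hsemi (hn _).1 hs0 (hle.trans_eq hs.symm))
      (hF.le_of_mul_self_le hArch hsemi hs0 (hn _).1 ?_)
    rw [hs, hrad, hsum, abs_of_nonneg h]
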